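/- Let $\mathcal A$ be a finite nonempty set of actions and let a bandit be a stochastic process $R=(R_t)_{t\ge 1}$ with values in $\mathbb R^{\mathcal A}$ such that every reward $R_{t,a}$ is integrable; $R_{t+1,a}$ is the reward received for executing action $a$ at time $t\ge 0$. A policy $\pi$ maps each history (finite sequence of action-reward pairs) to a probability distribution on $\mathcal A$. An agent executing $\pi$ selects actions $A_0^\pi,A_1^\pi,\dots$ (random variables on the same probability space as $R$) such that, with $H_t^\pi=(A_0^\pi,R_{1,A_0^\pi},\dots,A_{t-1}^\pi,R_{t,A_{t-1}^\pi})$, one has $\mathbb P(A_t^\pi\in\cdot\mid H_t^\pi)=\pi(\cdot\mid H_t^\pi)$ and $A_t^\pi$ is independent of $R_{1:\infty}$ conditioned on $H_t^\pi$, for every $t\ge 0$. Let $(f_t)_{t\ge1}$ be deterministic (measurable) functions, $\alpha_t=f_t(R_t)$ for $t \ge 1$, and let $\chi=(\chi_t)_{t\ge0}$ be any stochastic process on the same probability space. The state spaces of $\alpha_t$ and $\chi_t$ are arbitrary measurable spaces and may depend on $t$. For $t\ge 0$ and $T\ge1$ put $$\mathrm{Regret}^\chi_{\mathrm{ins}}(t;\pi)=\mathbb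 E\Big[\max_{a\in\mathcal A}\mathbb E[R_{t+1,a}\mid\chi_t]-R_{t+1,A_t^\pi}\Big],\qquad \mathrm{Regret}^\chi(T;\pi)=\sum_{t=0}^{T-1}\mathrm{Regret}^\chi_{\mathrm{ins}}(t;\pi),$$ $$V_T(\alpha)=\sum_{t=0}^{T-1}\mathbb I(\alpha_{t+2:\infty};R_{t+1}\mid R_{1:t})\in[0,\infty],\qquad \Gamma_t^\pi(\chi;\alpha)=\frac{\mathrm{Regret}^\chi_{\mathrm{ins}}(t;\pi)^2}{\mathbb I(\alpha_{t+2:\infty};A_t^\pi,R_{t+1,A_t^\pi}\mid H_t^\pi)}\in[0,\infty],$$ where $\mathbb I(X;Y\mid Z)\in[0,\infty]$ is conditional mutual information and, in $\Gamma_t^\pi$, $0/0=0$, and $c/0=\infty$ and $c/\infty=0$ for $c>0$ (also $0/\infty=0$). Then for all $(f_t)$, $\chi$, $\pi$ and all integers $T\ge1$, $$\mathrm{Regret}^\chi(T;\pi)\le\sqrt{\Big(\sum_{t=0}^{T-1}\Gamma_t^\pi(\chi;\alpha)\Big)\,V_T(\alpha)},$$ provided that the product under the root is not of the indeterminate form $0\cdot\infty$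 or $\infty\cdot0$. The bandit may be stationary or not. -/

import Mathlib

open MeasureTheory ProbabilityTheory Finset
open scoped ENNReal

noncomputable section

namespace NSBandit

section Information

variable {Ω 𝓧 𝓨 𝓩 : Type*} [MeasurableSpace Ω] [MeasurableSpace 𝓧] [MeasurableSpace 𝓨]
  [MeasurableSpace 𝓩]

/-- `X` and `Y` are independent conditioned on `Z`:
`P(X ∈ s, Y ∈ u | Z) = P(X ∈ s | Z) P(Y ∈ u | Z)` almost surely, for all measurable `s`, `u`.
(On a standard Borel `Ω` this is `ProbabilityTheory.CondIndepFun`; no such restriction on the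
underlying probability space is made here.) -/
def CondIndepRV (X : Ω → 𝓧) (Y : Ω → 𝓨) (Z : Ω → 𝓩) (μ : Measure Ω) : Prop :=
  ∀ (s : Set 𝓧) (u : Set 𝓨), MeasurableSet s → MeasurableSet u →
    μ⟦X ⁻¹' s ∩ Y ⁻¹' u | MeasurableSpace.comap Z inferInstance⟧ =ᵐ[μ]
      fun ω ↦ (μ⟦X ⁻¹' s | MeasurableSpace.comap Z inferInstance⟧) ω *
        (μ⟦Y ⁻¹' u | MeasurableSpace.comap Z inferInstance⟧) ω

/-- The conditional mutual information `I(X; Y | Z) ∈ [0, ∞]` (in nats): the Kullback-Leibler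
divergence of the joint law `P_{X,Z,Y}` from the law `P_{X,Z} ⊗ P_{Y|Z} = P_Z ⊗ P_{X|Z} ⊗ P_{Y|Z}`,
under which `X` and `Y` are conditionally independent given `Z` and the pairs `(X, Z)` and `(Y, Z)`
have their original laws. Only `Y` has to take values in a standard Borel space. -/
def condMutualInfo [StandardBorelSpace 𝓨] [Nonempty 𝓨] (X : Ω → 𝓧) (Y : Ω → 𝓨) (Z : Ω → 𝓩)
    (μ : Measure Ω) [IsFiniteMeasure μ] : ℝ≥0∞ :=
  InformationTheory.klDiv (μ.map fun ω ↦ ((X ω, Z ω), Y ω))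
    ((μ.map fun ω ↦ (X ω, Z ω)) ⊗ₘ Kernel.prodMkLeft 𝓧 (condDistrib Y Z μ))

end Information

/-- A policy with action set `𝓐`: it maps each history, that is, each finite sequence of
action-reward pairs, (measurably) to a probability distribution over `𝓐`. -/
structure Policy (𝓐 : Type*) [MeasurableSpace 𝓐] where
  /-- the action distribution as a function of the histories of length `t` -/
  kernel : (t : ℕ) → Kernel (Fin t → 𝓐 × ℝ) 𝓐
  isMarkovKernel : ∀ t, IsMarkovKernel (kernel t)

section Processes

variable {Ω : Type*} {S : ℕ → Type*}

/-- The tail `ξ_{m:∞} = (ξ_m, ξ_{m+1}, …)` of a process. -/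
def tail (ξ : (t : ℕ) → Ω → S t) (m : ℕ) (ω : Ω) : (n : ℕ) → S (m + n) :=
  fun n ↦ ξ (m + n) ω

end Processes

/-! A bandit is a process `R`, where `R t ω a` is the reward `R_{t,a}` for `t ≥ 1`; the value
`R 0` is never used. Likewise `α 0` is never used for a process `α = (α_t)_{t ≥ 1}`. -/

section Bandit

variable {Ω 𝓐 : Type*} [MeasurableSpace Ω] [MeasurableSpace 𝓐]

/-- The reward sequence `R_{1:t} = (R_1, …, R_t)`. -/
def rewardsUpTo (R : ℕ → Ω → 𝓐 → ℝ) (t : ℕ) (ω : Ω) : Fin t → 𝓐 → ℝ :=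
  fun i ↦ R (i + 1) ω

/-- The history `H_t = (A_0, R_{1,A_0}, …, A_{t-1}, R_{t,A_{t-1}})`. -/
def history (R : ℕ → Ω → 𝓐 → ℝ) (A : ℕ → Ω → 𝓐) (t : ℕ) (ω : Ω) : Fin t → 𝓐 × ℝ :=
  fun i ↦ (A i ω, R (i + 1) ω (A i ω))

/-- `A_0, A_1, …` are the actions selected by an agent that executes the policy `π` in the bandit
`R`: `P(A_t ∈ · | H_t) = π(· | H_t)`, and `A_t` is independent of `R_{1:∞}` conditioned on `H_t`. -/
structure IsExecution (R : ℕ → Ω → 𝓐 → ℝ) (π : Policy 𝓐) (A : ℕ → Ω → 𝓐) (μ : Measure Ω) :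
    Prop where
  measurable : ∀ t, Measurable (A t)
  law : ∀ (t : ℕ) (s : Set 𝓐), MeasurableSet s →
    μ⟦A t ⁻¹' s | MeasurableSpace.comap (history R A t) inferInstance⟧ =ᵐ[μ]
      fun ω ↦ (π.kernel t (history R A t ω)).real s
  condIndep : ∀ t, CondIndepRV (A t) (tail R 1) (history R A t) μ

/-- `R_{t+1,⋆}^χ = max_a E[R_{t+1,a} | χ_t]`. -/
def oracleReward {C : ℕ → Type*} [∀ t, MeasurableSpace (C t)] (R : ℕ → Ω → 𝓐 → ℝ)
    (χ : (t : ℕ) → Ω → C t) (μ : Measure Ω) (t : ℕ) (ω : Ω) : ℝ :=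
  ⨆ a, (μ[fun ω' ↦ R (t + 1) ω' a | MeasurableSpace.comap (χ t) inferInstance]) ω

/-- The instantaneous regret `E[R_{t+1,⋆}^χ - R_{t+1,A_t}]`. -/
def instRegret {C : ℕ → Type*} [∀ t, MeasurableSpace (C t)] (R : ℕ → Ω → 𝓐 → ℝ)
    (χ : (t : ℕ) → Ω → C t) (A : ℕ → Ω → 𝓐) (μ : Measure Ω) (t : ℕ) : ℝ :=
  ∫ ω, (oracleReward R χ μ t ω - R (t + 1) ω (A t ω)) ∂μ

/-- The regret over `T` timesteps. -/
def regret {C : ℕ → Type*} [∀ t, MeasurableSpace (C t)] (R : ℕ → Ω → 𝓐 → ℝ)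
    (χ : (t : ℕ) → Ω → C t) (A : ℕ → Ω → 𝓐) (μ : Measure Ω) (T : ℕ) : ℝ :=
  ∑ t ∈ range T, instRegret R χ A μ t

variable [Fintype 𝓐] [MeasurableSingletonClass 𝓐] [Nonempty 𝓐]
  {S : ℕ → Type*} [∀ t, MeasurableSpace (S t)]

/-- The incremental predictive information `Δ_t(α) = I(α_{t+2:∞}; R_{t+1} | R_{1:t})`. -/
def incrPredictiveInfo (R : ℕ → Ω → 𝓐 → ℝ) (α : (t : ℕ) → Ω → S t) (μ : Measure Ω)
    [IsFiniteMeasure μ] (t : ℕ) : ℝ≥0∞ :=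
  condMutualInfo (tail α (t + 2)) (R (t + 1)) (rewardsUpTo R t) μ

/-- The cumulative predictive information `V_T(α) = ∑_{t < T} Δ_t(α)`. -/
def cumPredictiveInfo (R : ℕ → Ω → 𝓐 → ℝ) (α : (t : ℕ) → Ω → S t) (μ : Measure Ω)
    [IsFiniteMeasure μ] (T : ℕ) : ℝ≥0∞ :=
  ∑ t ∈ range T, incrPredictiveInfo R α μ t

/-- The information gain `I(α_{t+2:∞}; A_t, R_{t+1,A_t} | H_t)`. -/
def infoGain (R : ℕ → Ω → 𝓐 → ℝ) (α : (t : ℕ) → Ω → S t) (A : ℕ → Ω → 𝓐) (μ : Measure Ω)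
    [IsFiniteMeasure μ] (t : ℕ) : ℝ≥0∞ :=
  condMutualInfo (tail α (t + 2)) (fun ω ↦ (A t ω, R (t + 1) ω (A t ω))) (history R A t) μ

/-- The information ratio `Γ_t(χ; α) ∈ [0, ∞]`: the squared instantaneous regret over the
information gain. In `ℝ≥0∞`, `c / 0 = ∞` and `c / ∞ = 0` for real `c > 0`, and `0 / 0 = 0`. -/
def infoRatio {C : ℕ → Type*} [∀ t, MeasurableSpace (C t)] (R : ℕ → Ω → 𝓐 → ℝ)
    (χ : (t : ℕ) → Ω → C t) (α : (t : ℕ) → Ω → S t) (A : ℕ → Ω → 𝓐) (μ : Measure Ω)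
    [IsFiniteMeasure μ] (t : ℕ) : ℝ≥0∞ :=
  ENNReal.ofReal (instRegret R χ A μ t ^ 2) / infoGain R α A μ t

end Bandit

end NSBandit

end

/-! Once the information gains are known to sum to at most `V_T(α)`, the bound is Cauchy-Schwarz: in
the finite case the squared instantaneous regret is `Γ_t` times the gain
(`sum_le_sqrt_sum_ratio_mul`).

The gains are summed by a potential argument (`IsExecution.sum_infoGain_le`). Let `D_t =
I(α_{t+1:∞}; R_{1:t} | H_t)`: what past rewards tell about the future of `α` beyond what the agent
has seen. Given `R_{1:t}`, the history carries no further information about the rewards, so `I(X;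
R_{1:t}) = I(X; H_t) + I(X; R_{1:t} | H_t)` for every `X` that is a function of the rewards
(`IsExecution.mutualInfo_rewardsUpTo`). Take `X = α_{t+2:∞}`, subtract this identity at `t` from the
one at `t + 1` and apply the chain rule: `gain_t + D_{t+1} = I(X; R_{1:t} | H_t) + Δ_t ≤ D_t + Δ_t`,
the inequality being data processing. This telescopes from `D_0 = 0`. -/

namespace NSBandit

/-! ### Mutual information: data processing and chain rule. -/

section MutualInformation

variable {Ω 𝓧 𝓧' 𝓨 𝓨' 𝓩 : Type*} [MeasurableSpace Ω] [MeasurableSpace 𝓧] [MeasurableSpace 𝓧']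
  [MeasurableSpace 𝓨] [MeasurableSpace 𝓨'] [MeasurableSpace 𝓩]

/-- The mutual information `I(X; Y)`. -/
noncomputable def mutualInfo (X : Ω → 𝓧) (Y : Ω → 𝓨) (μ : Measure Ω) : ℝ≥0∞ :=
  InformationTheory.klDiv (μ.map fun ω ↦ (X ω, Y ω)) ((μ.map X).prod (μ.map Y))

variable {μ : Measure Ω} [IsProbabilityMeasure μ]

/-- Data processing inequality for mutual information. -/
lemma mutualInfo_comp_le {X : Ω → 𝓧} {Y : Ω → 𝓨} (hX : Measurable X) (hY : Measurable Y)
    {g : 𝓧 → 𝓧'} {h : 𝓨 → 𝓨'} (hg : Measurable g) (hh : Measurable h) :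
    mutualInfo (fun ω ↦ g (X ω)) (fun ω ↦ h (Y ω)) μ ≤ mutualInfo X Y μ := by
  have := Measure.isProbabilityMeasure_map (μ := μ) hX.aemeasurable
  have := Measure.isProbabilityMeasure_map (μ := μ) hY.aemeasurable
  have h1 : (μ.map fun ω ↦ (g (X ω), h (Y ω))) =
      (μ.map fun ω ↦ (X ω, Y ω)).map (Prod.map g h) := by
    rw [Measure.map_map (hg.prodMap hh) (hX.prodMk hY)]; rfl
  have h2 : (μ.map fun ω ↦ g (X ω)).prod (μ.map fun ω ↦ h (Y ω)) =
      ((μ.map X).prod (μ.map Y)).map (Prod.map g h) := by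
    rw [← Measure.map_prod_map _ _ hg hh, Measure.map_map hg hX, Measure.map_map hh hY]; rfl
  rw [mutualInfo, h1, h2]
  exact InformationTheory.klDiv_map_le _ _ (hg.prodMap hh)

/-- Mutual information is invariant under an injective recoding of its second argument. -/
lemma mutualInfo_comp_right {X : Ω → 𝓧} {Y : Ω → 𝓨} (hX : Measurable X) (hY : Measurable Y)
    {h : 𝓨 → 𝓨'} {k : 𝓨' → 𝓨} (hh : Measurable h) (hk : Measurable k)
    (hkh : ∀ y, k (h y) = y) :
    mutualInfo X (fun ω ↦ h (Y ω)) μ = mutualInfo X Y μ := by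
  refine le_antisymm (mutualInfo_comp_le hX hY measurable_id hh) ?_
  have := mutualInfo_comp_le (μ := μ) hX (hh.comp hY) measurable_id hk
  simpa [hkh, Function.comp_def] using this

lemma mutualInfo_of_subsingleton [Subsingleton 𝓨] {X : Ω → 𝓧} {Y : Ω → 𝓨}
    (hX : Measurable X) : mutualInfo X Y μ = 0 := by
  obtain ⟨ω₀⟩ : Nonempty Ω := nonempty_of_isProbabilityMeasure μ
  have hY : Y = fun _ ↦ Y ω₀ := funext fun ω ↦ Subsingleton.elim _ _
  have := Measure.isProbabilityMeasure_map (μ := μ) hX.aemeasurable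
  have h : (μ.map fun ω ↦ (X ω, Y ω)) = (μ.map X).prod (μ.map Y) := by
    rw [hY, Measure.map_const, measure_univ, one_smul, Measure.prod_dirac,
      Measure.map_map (by fun_prop) hX]
    rfl
  rw [mutualInfo, h]
  have : IsFiniteMeasure ((μ.map X).prod (μ.map Y)) := by rw [← h]; infer_instance
  exact InformationTheory.klDiv_self _

lemma map_prodMap_compProd_prodMkLeft {ν : Measure (𝓧 × 𝓩)} [SFinite ν] (κ : Kernel 𝓩 𝓨)
    [IsMarkovKernel κ] {g : 𝓧 → 𝓧'} (hg : Measurable g) :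
    (ν ⊗ₘ Kernel.prodMkLeft 𝓧 κ).map (Prod.map (Prod.map g id) id) =
      (ν.map (Prod.map g id)) ⊗ₘ Kernel.prodMkLeft 𝓧' κ := by
  have hg' : Measurable (Prod.map g (id : 𝓩 → 𝓩)) := hg.prodMap measurable_id
  refine Measure.ext_of_lintegral _ fun F hF ↦ ?_
  rw [lintegral_map hF (by fun_prop), Measure.lintegral_compProd (by fun_prop),
    Measure.lintegral_compProd hF, lintegral_map ?_ hg']
  · rfl
  · exact Measurable.lintegral_kernel_prod_right' hF

/-- Brings the product law `P_X ⊗ P_{(Z,Y)}` into the form to which the chain rule for `klDiv`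
applies. -/
lemma map_prodAssoc_symm_prod_compProd {ν : Measure 𝓧} {ρ : Measure 𝓩} [SFinite ν] [SFinite ρ]
    (κ : Kernel 𝓩 𝓨) [IsMarkovKernel κ] :
    (ν.prod (ρ ⊗ₘ κ)).map MeasurableEquiv.prodAssoc.symm =
      (ν.prod ρ) ⊗ₘ Kernel.prodMkLeft 𝓧 κ := by
  refine Measure.ext_of_lintegral _ fun F hF ↦ ?_
  rw [lintegral_map hF (by fun_prop), Measure.lintegral_compProd hF,
    lintegral_prod _ (by fun_prop), lintegral_prod]
  · refine lintegral_congr fun x ↦ ?_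
    rw [Measure.lintegral_compProd (by fun_prop)]
    rfl
  · exact (Measurable.lintegral_kernel_prod_right' hF).aemeasurable

lemma klDiv_map_measurableEquiv (ν ρ : Measure 𝓧) [IsFiniteMeasure ν] [IsFiniteMeasure ρ]
    (e : 𝓧 ≃ᵐ 𝓨) :
    InformationTheory.klDiv (ν.map e) (ρ.map e) = InformationTheory.klDiv ν ρ := by
  refine le_antisymm (InformationTheory.klDiv_map_le _ _ e.measurable) ?_
  have := InformationTheory.klDiv_map_le (ν.map e) (ρ.map e) e.symm.measurable
  simpa [Measure.map_map] using this

variable [StandardBorelSpace 𝓨] [Nonempty 𝓨]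

/-- The chain rule for mutual information. -/
lemma mutualInfo_prodMk {X : Ω → 𝓧} {Y : Ω → 𝓨} {Z : Ω → 𝓩} (hX : Measurable X)
    (hY : Measurable Y) (hZ : Measurable Z) :
    mutualInfo X (fun ω ↦ (Z ω, Y ω)) μ = mutualInfo X Z μ + condMutualInfo X Y Z μ := by
  have := Measure.isProbabilityMeasure_map (μ := μ) hX.aemeasurable
  have := Measure.isProbabilityMeasure_map (μ := μ) hZ.aemeasurable
  have := Measure.isProbabilityMeasure_map (μ := μ) (hZ.prodMk hY).aemeasurable
  have := Measure.isProbabilityMeasure_map (μ := μ) (hX.prodMk hZ).aemeasurable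
  have := Measure.isProbabilityMeasure_map (μ := μ) (hX.prodMk (hZ.prodMk hY)).aemeasurable
  have h1 : (μ.map fun ω ↦ (X ω, (Z ω, Y ω))).map MeasurableEquiv.prodAssoc.symm =
      μ.map fun ω ↦ ((X ω, Z ω), Y ω) := by
    rw [Measure.map_map (by fun_prop) (by fun_prop)]; rfl
  have h2 : ((μ.map X).prod (μ.map fun ω ↦ (Z ω, Y ω))).map MeasurableEquiv.prodAssoc.symm =
      ((μ.map X).prod (μ.map Z)) ⊗ₘ Kernel.prodMkLeft 𝓧 (condDistrib Y Z μ) := by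
    rw [← map_prodAssoc_symm_prod_compProd, compProd_map_condDistrib hY.aemeasurable]
  -- Both laws are now disintegrated over `(X, Z)`, with kernels `P_{Y|X,Z}` and `P_{Y|Z}`. The
  -- kernel term of the `klDiv` chain rule is the conditional mutual information.
  rw [mutualInfo, ← klDiv_map_measurableEquiv _ _ MeasurableEquiv.prodAssoc.symm, h1, h2,
    ← compProd_map_condDistrib (X := fun ω ↦ (X ω, Z ω)) hY.aemeasurable,
    InformationTheory.klDiv_compProd_eq_add, mutualInfo, condMutualInfo,
    compProd_map_condDistrib hY.aemeasurable]

/-- Data processing inequality for conditional mutual information. -/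
lemma condMutualInfo_comp_le {X : Ω → 𝓧} {Y : Ω → 𝓨} {Z : Ω → 𝓩} (hX : Measurable X)
    (hY : Measurable Y) (hZ : Measurable Z) {g : 𝓧 → 𝓧'} (hg : Measurable g) :
    condMutualInfo (fun ω ↦ g (X ω)) Y Z μ ≤ condMutualInfo X Y Z μ := by
  have h1 : (μ.map fun ω ↦ ((g (X ω), Z ω), Y ω)) =
      (μ.map fun ω ↦ ((X ω, Z ω), Y ω)).map (Prod.map (Prod.map g id) id) := by
    rw [Measure.map_map (by fun_prop) (by fun_prop)]; rfl
  have h2 : (μ.map fun ω ↦ (g (X ω), Z ω)) =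
      (μ.map fun ω ↦ (X ω, Z ω)).map (Prod.map g id) := by
    rw [Measure.map_map (by fun_prop) (by fun_prop)]; rfl
  rw [condMutualInfo, h1, h2, ← map_prodMap_compProd_prodMkLeft _ hg]
  exact InformationTheory.klDiv_map_le _ _ (by fun_prop)

/-- If `Y` is generated from `Z` by a kernel, independently of `X`, then `I(X; Y | Z) = 0`. -/
lemma condMutualInfo_eq_zero {X : Ω → 𝓧} {Y : Ω → 𝓨} {Z : Ω → 𝓩} (hX : Measurable X)
    (hY : Measurable Y) (hZ : Measurable Z) (κ : Kernel 𝓩 𝓨) [IsMarkovKernel κ]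
    (h : (μ.map fun ω ↦ ((X ω, Z ω), Y ω)) =
      (μ.map fun ω ↦ (X ω, Z ω)) ⊗ₘ Kernel.prodMkLeft 𝓧 κ) :
    condMutualInfo X Y Z μ = 0 := by
  have hZY : (μ.map fun ω ↦ (Z ω, Y ω)) = μ.map Z ⊗ₘ κ := by
    have h1 : (μ.map fun ω ↦ (Z ω, Y ω)) =
        (μ.map fun ω ↦ ((X ω, Z ω), Y ω)).map (Prod.map Prod.snd id) := by
      rw [Measure.map_map (by fun_prop) (by fun_prop)]; rfl
    have h2 : μ.map Z = (μ.map fun ω ↦ (X ω, Z ω)).map Prod.snd := by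
      rw [Measure.map_map (by fun_prop) (by fun_prop)]; rfl
    rw [h1, h, h2]
    refine Measure.ext_of_lintegral _ fun F hF ↦ ?_
    rw [lintegral_map hF (by fun_prop), Measure.lintegral_compProd (by fun_prop),
      Measure.lintegral_compProd hF, lintegral_map ?_ measurable_snd]
    · rfl
    · exact Measurable.lintegral_kernel_prod_right' hF
  -- By uniqueness of disintegrations `κ` is the conditional law of `Y`, so both arguments of
  -- `klDiv` coincide.
  have hae := condDistrib_ae_eq_of_measure_eq_compProd Z hY.aemeasurable hZY
  have h3 : Kernel.prodMkLeft 𝓧 (condDistrib Y Z μ) =ᵐ[μ.map fun ω ↦ (X ω, Z ω)]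
      Kernel.prodMkLeft 𝓧 κ := by
    have h4 : μ.map Z = (μ.map fun ω ↦ (X ω, Z ω)).map Prod.snd := by
      rw [Measure.map_map (by fun_prop) (by fun_prop)]; rfl
    rw [h4] at hae
    filter_upwards [ae_of_ae_map measurable_snd.aemeasurable hae] with p hp
    simpa [Kernel.prodMkLeft_apply] using hp
  rw [condMutualInfo, h, Measure.compProd_congr h3]
  exact InformationTheory.klDiv_self _

end MutualInformation

/-! ### From conditional independence to a disintegration. -/

section ConditionalLaw

variable {Ω 𝓧 𝓨 𝓩 : Type*} [MeasurableSpace Ω] [MeasurableSpace 𝓧] [MeasurableSpace 𝓨]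
  [MeasurableSpace 𝓩] {μ : Measure Ω} [IsProbabilityMeasure μ]

/-- If `κ` is the conditional law of `Y` given `Z`, and `Y` is conditionally independent of `X`
given `Z`, then `κ` is the conditional law of `Y` given `(X, Z)`. -/
lemma CondIndepRV.map_eq_compProd {X : Ω → 𝓧} {Y : Ω → 𝓨} {Z : Ω → 𝓩} (hX : Measurable X)
    (hY : Measurable Y) (hZ : Measurable Z) {κ : Kernel 𝓩 𝓨} [IsMarkovKernel κ]
    (hκ : ∀ s, MeasurableSet s →
      μ⟦Y ⁻¹' s | MeasurableSpace.comap Z inferInstance⟧ =ᵐ[μ] fun ω ↦ (κ (Z ω)).real s)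
    (h : CondIndepRV Y X Z μ) :
    (μ.map fun ω ↦ ((X ω, Z ω), Y ω)) =
      (μ.map fun ω ↦ (X ω, Z ω)) ⊗ₘ Kernel.prodMkLeft 𝓧 κ := by
  have hm := hZ.comap_le
  have hXZ : Measurable fun ω ↦ (X ω, Z ω) := hX.prodMk hZ
  refine Measure.ext_prod₃' fun {s t u} hs ht hu ↦ ?_
  have hsX := hX hs
  have htZ := hZ ht
  have huY := hY hu
  have hκm : Measurable fun z ↦ (κ z).real u := (κ.measurable_coe hu).ennreal_toReal
  have hκb : ∀ z, ‖(κ z).real u‖ ≤ 1 := fun z ↦ by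
    rw [Real.norm_of_nonneg measureReal_nonneg]; exact measureReal_le_one
  have hκi : Integrable (fun ω ↦ (κ (Z ω)).real u) μ :=
    Integrable.of_bound (hκm.comp hZ).aestronglyMeasurable 1 (.of_forall fun ω ↦ hκb _)
  have hmul : (fun ω ↦ (κ (Z ω)).real u * (X ⁻¹' s).indicator (fun _ ↦ (1 : ℝ)) ω) =
      (X ⁻¹' s).indicator fun ω ↦ (κ (Z ω)).real u := by
    ext ω; by_cases hω : ω ∈ X ⁻¹' s <;> simp [hω]
  -- Pulling out the `Z`-measurable factor yields the same product as conditional independence does.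
  have hpull : μ[(X ⁻¹' s).indicator fun ω ↦ (κ (Z ω)).real u |
      MeasurableSpace.comap Z inferInstance] =ᵐ[μ] fun ω ↦ (κ (Z ω)).real u *
        (μ⟦X ⁻¹' s | MeasurableSpace.comap Z inferInstance⟧) ω := by
    rw [← hmul]
    refine condExp_mul_of_stronglyMeasurable_left
      (hκm.comp (comap_measurable Z)).stronglyMeasurable ?_
      ((integrable_const 1).indicator hsX)
    exact (hκi.indicator hsX).congr (.of_forall fun ω ↦ (congrFun hmul ω).symm)
  have hreal : μ.real (Z ⁻¹' t ∩ (Y ⁻¹' u ∩ X ⁻¹' s)) =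
      ∫ ω in Z ⁻¹' t ∩ X ⁻¹' s, (κ (Z ω)).real u ∂μ := by
    calc μ.real (Z ⁻¹' t ∩ (Y ⁻¹' u ∩ X ⁻¹' s))
        = ∫ ω in Z ⁻¹' t, (Y ⁻¹' u ∩ X ⁻¹' s).indicator (fun _ ↦ (1 : ℝ)) ω ∂μ := by
          rw [setIntegral_indicator (huY.inter hsX)]; simp
      _ = ∫ ω in Z ⁻¹' t,
            (μ⟦Y ⁻¹' u ∩ X ⁻¹' s | MeasurableSpace.comap Z inferInstance⟧) ω ∂μ :=
          (setIntegral_condExp hm ((integrable_const 1).indicator (huY.inter hsX))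
            ⟨t, ht, rfl⟩).symm
      _ = ∫ ω in Z ⁻¹' t, (μ[(X ⁻¹' s).indicator fun ω ↦ (κ (Z ω)).real u |
            MeasurableSpace.comap Z inferInstance]) ω ∂μ := by
          refine setIntegral_congr_ae htZ ?_
          filter_upwards [h u s hu hs, hκ u hu, hpull] with ω h1 h2 h3 _
          rw [h1, h2, h3]
      _ = ∫ ω in Z ⁻¹' t, (X ⁻¹' s).indicator (fun ω ↦ (κ (Z ω)).real u) ω ∂μ :=
          setIntegral_condExp hm (hκi.indicator hsX) ⟨t, ht, rfl⟩
      _ = ∫ ω in Z ⁻¹' t ∩ X ⁻¹' s, (κ (Z ω)).real u ∂μ := setIntegral_indicator hsX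
  have hset : (fun ω ↦ ((X ω, Z ω), Y ω)) ⁻¹' ((s ×ˢ t) ×ˢ u) =
      Z ⁻¹' t ∩ (Y ⁻¹' u ∩ X ⁻¹' s) := by
    ext ω; simp only [Set.mem_preimage, Set.mem_prod, Set.mem_inter_iff]; tauto
  have hset' : (fun ω ↦ (X ω, Z ω)) ⁻¹' (s ×ˢ t) = Z ⁻¹' t ∩ X ⁻¹' s := by
    ext ω; simp only [Set.mem_preimage, Set.mem_prod, Set.mem_inter_iff]; tauto
  rw [Measure.map_apply (hXZ.prodMk hY) ((hs.prod ht).prod hu), hset,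
    Measure.compProd_apply_prod (hs.prod ht) hu,
    setLIntegral_map (hs.prod ht) (Kernel.measurable_coe _ hu) hXZ, hset',
    ← ofReal_measureReal, hreal,
    ofReal_integral_eq_lintegral_ofReal hκi.integrableOn (.of_forall fun _ ↦ measureReal_nonneg)]
  simp [Kernel.prodMkLeft_apply]

end ConditionalLaw

/-! ### Initial segments and tails of processes. -/

section PrefixProcess

variable {Ω 𝓧 β : Type*} [MeasurableSpace Ω] [MeasurableSpace 𝓧] [MeasurableSpace β]
  {μ : Measure Ω} [IsProbabilityMeasure μ]

/-- The chain rule for the mutual information of `X` and an initial segment of a process. -/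
lemma mutualInfo_fin_succ [StandardBorelSpace β] [Nonempty β] {X : Ω → 𝓧} (hX : Measurable X)
    {u : ℕ → Ω → β} (hu : ∀ n, Measurable (u n)) (t : ℕ) :
    mutualInfo X (fun ω (i : Fin (t + 1)) ↦ u i ω) μ =
      mutualInfo X (fun ω (i : Fin t) ↦ u i ω) μ +
        condMutualInfo X (u t) (fun ω (i : Fin t) ↦ u i ω) μ := by
  have hpre : ∀ n, Measurable fun ω (i : Fin n) ↦ u i ω := fun n ↦ by fun_prop
  rw [← mutualInfo_prodMk hX (hu t) (hpre t)]
  let h : (Fin (t + 1) → β) → (Fin t → β) × β := fun x ↦ (fun i ↦ x i.castSucc, x (Fin.last t))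
  let k : (Fin t → β) × β → Fin (t + 1) → β := fun p ↦ Fin.snoc (α := fun _ ↦ β) p.1 p.2
  have hk : Measurable k := by
    refine measurable_pi_lambda _ fun i ↦ ?_
    refine Fin.lastCases ?_ (fun j ↦ ?_) i
    · simpa [k] using measurable_snd
    · simp only [k, Fin.snoc_castSucc]
      fun_prop
  refine (mutualInfo_comp_right hX (hpre (t + 1)) (h := h) (k := k) (by fun_prop) hk
    fun y ↦ ?_).symm
  exact Fin.snoc_init_self y

end PrefixProcess

section Rewards

variable {Ω 𝓐 : Type*} {R : ℕ → Ω → 𝓐 → ℝ} {S : ℕ → Type*}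

/-- The reward sequence `R_{1:∞}`, indexed from `0`. -/
def rewardSeq (R : ℕ → Ω → 𝓐 → ℝ) (ω : Ω) : ℕ → 𝓐 → ℝ := fun n ↦ R (n + 1) ω

lemma tail_one_eq_rewardSeq (R : ℕ → Ω → 𝓐 → ℝ) : tail R 1 = rewardSeq R := by
  ext ω n a
  rw [tail, rewardSeq, add_comm]

lemma measurable_rewardSeq [MeasurableSpace Ω] (hR : ∀ t, 1 ≤ t → Measurable (R t)) :
    Measurable (rewardSeq R) :=
  measurable_pi_lambda _ fun n ↦ hR (n + 1) (by omega)

lemma measurable_rewardsUpTo [MeasurableSpace Ω] (hR : ∀ t, 1 ≤ t → Measurable (R t)) (t : ℕ) :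
    Measurable (rewardsUpTo R t) :=
  measurable_pi_lambda _ fun i ↦ hR (i + 1) (by omega)

/-- A tail is a measurable function of the preceding one. -/
lemma exists_measurable_tail_succ [∀ t, MeasurableSpace (S t)] (α : (t : ℕ) → Ω → S t) (m : ℕ) :
    ∃ g : ((n : ℕ) → S (m + n)) → (n : ℕ) → S (m + 1 + n), Measurable g ∧
      ∀ ω, tail α (m + 1) ω = g (tail α m ω) := by
  have hS : ∀ {k l : ℕ} (h : k = l), Measurable (cast (congrArg S h)) := by
    rintro k l rfl; exact measurable_id
  have hn : ∀ n, m + (n + 1) = m + 1 + n := fun n ↦ by omega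
  -- The shift needs a cast: `S (m + (n + 1))` and `S (m + 1 + n)` are only propositionally equal.
  refine ⟨fun x n ↦ cast (congrArg S (hn n)) (x (n + 1)), ?_, fun ω ↦ funext fun n ↦ ?_⟩
  · exact measurable_pi_lambda _ fun n ↦ (hS (hn n)).comp (measurable_pi_apply (n + 1))
  · have : ∀ {k l : ℕ} (h : k = l), α l ω = cast (congrArg S h) (α k ω) := by
      rintro k l rfl; rfl
    exact this (hn n)

/-- The tails of `α` are functions of the reward sequence. -/
lemma tail_eq_comp_rewardSeq {f : (t : ℕ) → (𝓐 → ℝ) → S t} {α : (t : ℕ) → Ω → S t}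
    (hα : ∀ t, 1 ≤ t → ∀ ω, α t ω = f t (R t ω)) (m : ℕ) :
    tail α (m + 1) =
      fun ω ↦ (fun (r : ℕ → 𝓐 → ℝ) n ↦ f (m + 1 + n) (r (m + n))) (rewardSeq R ω) := by
  ext ω n
  have h : m + 1 + n = m + n + 1 := by omega
  have hRn : R (m + 1 + n) ω = R (m + n + 1) ω := by rw [h]
  simp only [tail, rewardSeq, hα (m + 1 + n) (by omega) ω, hRn]

end Rewards

/-! ### The law of the history given the rewards. -/

section Execution

variable {Ω 𝓐 : Type*} [MeasurableSpace Ω] [MeasurableSpace 𝓐] [Fintype 𝓐]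
  [MeasurableSingletonClass 𝓐] {μ : Measure Ω} [IsProbabilityMeasure μ]
  {R : ℕ → Ω → 𝓐 → ℝ} {π : Policy 𝓐} {A : ℕ → Ω → 𝓐}

lemma measurable_eval_action :
    Measurable fun p : (𝓐 → ℝ) × 𝓐 ↦ p.1 p.2 :=
  measurable_from_prod_countable_left fun a ↦ measurable_pi_apply a

lemma measurable_actionReward (hR : ∀ t, 1 ≤ t → Measurable (R t)) (hA : ∀ t, Measurable (A t))
    (t : ℕ) : Measurable fun ω ↦ (A t ω, R (t + 1) ω (A t ω)) :=
  (hA t).prodMk (measurable_eval_action.comp ((hR (t + 1) (by omega)).prodMk (hA t)))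

lemma measurable_history (hR : ∀ t, 1 ≤ t → Measurable (R t)) (hA : ∀ t, Measurable (A t))
    (t : ℕ) : Measurable (history R A t) :=
  measurable_pi_lambda _ fun i ↦ measurable_actionReward hR hA i

/-- The history `H_t` is generated by a kernel from `R_{1:t}`, independently of the later
rewards. -/
lemma IsExecution.exists_kernel_history (hA : IsExecution R π A μ)
    (hR : ∀ t, 1 ≤ t → Measurable (R t)) (t : ℕ) :
    ∃ κ : Kernel (Fin t → 𝓐 → ℝ) (Fin t → 𝓐 × ℝ), IsMarkovKernel κ ∧
      (μ.map fun ω ↦ (rewardSeq R ω, history R A t ω)) =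
        (μ.map (rewardSeq R)) ⊗ₘ κ.comap (fun r i ↦ r i) (by fun_prop) := by
  have hRs := measurable_rewardSeq hR
  induction t with
  | zero =>
    refine ⟨Kernel.deterministic (fun _ ↦ Fin.elim0) measurable_const, inferInstance, ?_⟩
    refine Measure.ext_of_lintegral _ fun F hF ↦ ?_
    have hH : ∀ ω, history R A 0 ω = Fin.elim0 := fun ω ↦ Subsingleton.elim _ _
    rw [Measure.lintegral_compProd hF,
      lintegral_map hF (hRs.prodMk (measurable_history hR hA.measurable 0)),
      lintegral_map (Measurable.lintegral_kernel_prod_right' hF) hRs]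
    refine lintegral_congr fun ω ↦ ?_
    rw [Kernel.comap_apply, Kernel.deterministic_apply, lintegral_dirac' _ (by fun_prop), hH]
  | succ t ih =>
    obtain ⟨κ, hκ, ih⟩ := ih
    have := π.isMarkovKernel t
    -- `η` draws `H_t` from `R_{1:t}`, then `A_t` from the policy; `G` appends `A_t` and its reward,
    -- read off `R_{t+1}`.
    let η : Kernel (Fin (t + 1) → 𝓐 → ℝ) ((Fin t → 𝓐 × ℝ) × 𝓐) :=
      (κ.comap (fun r i ↦ r i.castSucc) (by fun_prop)) ⊗ₖ Kernel.prodMkLeft _ (π.kernel t)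
    let G : (Fin (t + 1) → 𝓐 → ℝ) × ((Fin t → 𝓐 × ℝ) × 𝓐) → Fin (t + 1) → 𝓐 × ℝ :=
      fun p ↦ Fin.snoc (α := fun _ ↦ 𝓐 × ℝ) p.2.1 (p.2.2, p.1 (Fin.last t) p.2.2)
    have hG : Measurable G := by
      refine measurable_pi_lambda _ fun i ↦ ?_
      refine Fin.lastCases ?_ (fun j ↦ ?_) i
      · simp only [G, Fin.snoc_last]
        refine Measurable.prodMk (by fun_prop) (measurable_eval_action.comp
          (f := fun p : (Fin (t + 1) → 𝓐 → ℝ) × ((Fin t → 𝓐 × ℝ) × 𝓐) ↦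
            (p.1 (Fin.last t), p.2.2)) (by fun_prop))
      · simp only [G, Fin.snoc_castSucc]
        fun_prop
    refine ⟨(Kernel.id ×ₖ η).map G, Kernel.IsMarkovKernel.map _ hG, ?_⟩
    have hH := measurable_history hR hA.measurable
    have hcond := CondIndepRV.map_eq_compProd hRs (hA.measurable t) (hH t) (hA.law t)
      (tail_one_eq_rewardSeq R ▸ hA.condIndep t)
    have hsnoc : ∀ ω, history R A (t + 1) ω =
        G (fun i ↦ rewardSeq R ω i, history R A t ω, A t ω) := fun ω ↦
      (Fin.snoc_init_self (history R A (t + 1) ω)).symm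
    refine Measure.ext_of_lintegral _ fun F hF ↦ ?_
    let F' : ((ℕ → 𝓐 → ℝ) × (Fin t → 𝓐 × ℝ)) × 𝓐 → ℝ≥0∞ :=
      fun p ↦ F (p.1.1, G (fun i ↦ p.1.1 i, p.1.2, p.2))
    have hF' : Measurable F' := by fun_prop
    calc ∫⁻ p, F p ∂(μ.map fun ω ↦ (rewardSeq R ω, history R A (t + 1) ω))
        = ∫⁻ ω, F' ((rewardSeq R ω, history R A t ω), A t ω) ∂μ := by
          rw [lintegral_map hF (hRs.prodMk (hH (t + 1)))]
          simp only [F', hsnoc]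
      _ = ∫⁻ p, F' p ∂(μ.map fun ω ↦ ((rewardSeq R ω, history R A t ω), A t ω)) := by
          rw [lintegral_map hF' ((hRs.prodMk (hH t)).prodMk (hA.measurable t))]
      _ = ∫⁻ r, ∫⁻ h, ∫⁻ a, F' ((r, h), a) ∂(π.kernel t h) ∂(κ fun i ↦ r i)
            ∂(μ.map (rewardSeq R)) := by
          rw [hcond, Measure.lintegral_compProd hF', ih, Measure.lintegral_compProd]
          · rfl
          · exact Measurable.lintegral_kernel_prod_right' hF'
      _ = _ := by
          rw [Measure.lintegral_compProd hF]
          refine lintegral_congr fun r ↦ ?_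
          rw [Kernel.comap_apply, Kernel.lintegral_map _ hG _ (by fun_prop),
            Kernel.lintegral_prod _ _ _ (by fun_prop), Kernel.lintegral_id,
            Kernel.lintegral_compProd _ _ _ (by fun_prop)]
          rfl

/-- Given `R_{1:t}`, the history `H_t` carries no information about the reward sequence. -/
lemma IsExecution.condMutualInfo_history_eq_zero [Nonempty 𝓐] {𝓧 : Type*} [MeasurableSpace 𝓧]
    (hA : IsExecution R π A μ) (hR : ∀ t, 1 ≤ t → Measurable (R t)) (t : ℕ)
    {g : (ℕ → 𝓐 → ℝ) → 𝓧} (hg : Measurable g) :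
    condMutualInfo (fun ω ↦ g (rewardSeq R ω)) (history R A t) (rewardsUpTo R t) μ = 0 := by
  obtain ⟨κ, hκ, h⟩ := hA.exists_kernel_history hR t
  have hRs := measurable_rewardSeq hR
  have hH := measurable_history hR hA.measurable t
  have hRt := measurable_rewardsUpTo hR t
  refine condMutualInfo_eq_zero (hg.comp hRs) hH hRt κ ?_
  let q : (ℕ → 𝓐 → ℝ) → 𝓧 × (Fin t → 𝓐 → ℝ) := fun r ↦ (g r, fun i ↦ r i)
  have hq : Measurable q := by fun_prop
  have h1 : (μ.map fun ω ↦ ((g (rewardSeq R ω), rewardsUpTo R t ω), history R A t ω)) =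
      (μ.map fun ω ↦ (rewardSeq R ω, history R A t ω)).map (Prod.map q id) := by
    rw [Measure.map_map (by fun_prop) (hRs.prodMk hH)]; rfl
  have h2 : (μ.map fun ω ↦ (g (rewardSeq R ω), rewardsUpTo R t ω)) =
      (μ.map (rewardSeq R)).map q := by
    rw [Measure.map_map hq hRs]; rfl
  refine h1.trans ?_
  rw [h, h2]
  refine Measure.ext_of_lintegral _ fun F hF ↦ ?_
  rw [lintegral_map hF (by fun_prop), Measure.lintegral_compProd (by fun_prop),
    Measure.lintegral_compProd hF,
    lintegral_map (Measurable.lintegral_kernel_prod_right' hF) hq]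
  rfl

/-- The information in `R_{1:t}` splits into that in `H_t` and the remainder given `H_t`. -/
lemma IsExecution.mutualInfo_rewardsUpTo [Nonempty 𝓐] {𝓧 : Type*} [MeasurableSpace 𝓧]
    (hA : IsExecution R π A μ) (hR : ∀ t, 1 ≤ t → Measurable (R t)) (t : ℕ)
    {g : (ℕ → 𝓐 → ℝ) → 𝓧} (hg : Measurable g) {X : Ω → 𝓧} (hX : X = fun ω ↦ g (rewardSeq R ω)) :
    mutualInfo X (rewardsUpTo R t) μ = mutualInfo X (history R A t) μ +
      condMutualInfo X (rewardsUpTo R t) (history R A t) μ := by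
  have hH := measurable_history hR hA.measurable t
  have hRt := measurable_rewardsUpTo hR t
  have hXm : Measurable X := hX ▸ hg.comp (measurable_rewardSeq hR)
  -- Expand `I(X; H_t, R_{1:t})` in both orders; in one of them the term given `R_{1:t}` vanishes.
  rw [← mutualInfo_prodMk hXm hRt hH,
    ← mutualInfo_comp_right hXm (hH.prodMk hRt) measurable_swap measurable_swap Prod.swap_swap]
  simp only [Prod.swap_prod_mk]
  rw [mutualInfo_prodMk hXm hH hRt, hX, hA.condMutualInfo_history_eq_zero hR t hg, add_zero]

end Execution

/-! ### The potential argument. -/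

section InformationGain

variable {Ω 𝓐 : Type*} [MeasurableSpace Ω] [MeasurableSpace 𝓐] [Fintype 𝓐] [Nonempty 𝓐]
  [MeasurableSingletonClass 𝓐] {μ : Measure Ω} [IsProbabilityMeasure μ]
  {R : ℕ → Ω → 𝓐 → ℝ} {π : Policy 𝓐} {A : ℕ → Ω → 𝓐}
  {S : ℕ → Type*} [∀ t, MeasurableSpace (S t)] {f : (t : ℕ) → (𝓐 → ℝ) → S t}
  {α : (t : ℕ) → Ω → S t}

/-- The information gains of the agent sum to at most the cumulative predictive information. -/
lemma IsExecution.sum_infoGain_le (hA : IsExecution R π A μ)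
    (hR : ∀ t, 1 ≤ t → Measurable (R t)) (hf : ∀ t, 1 ≤ t → Measurable (f t))
    (hα : ∀ t, 1 ≤ t → ∀ ω, α t ω = f t (R t ω)) (T : ℕ) (hV : cumPredictiveInfo R α μ T ≠ ∞) :
    ∑ t ∈ range T, infoGain R α A μ t ≤ cumPredictiveInfo R α μ T := by
  have hH := measurable_history hR hA.measurable
  have hRt := measurable_rewardsUpTo hR
  have hgm : ∀ m, Measurable fun (r : ℕ → 𝓐 → ℝ) n ↦ f (m + 1 + n) (r (m + n)) := fun m ↦
    measurable_pi_lambda _ fun n ↦ (hf _ (by omega)).comp (measurable_pi_apply (m + n))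
  have hαm : ∀ m, Measurable (tail α (m + 1)) := fun m ↦
    tail_eq_comp_rewardSeq hα m ▸ (hgm m).comp (measurable_rewardSeq hR)
  -- The induction keeps the potential on the left. Finiteness is carried along because the step
  -- cancels `I(α_{T+2:∞}; H_T)` in `ℝ≥0∞`.
  suffices h : mutualInfo (tail α (T + 1)) (rewardsUpTo R T) μ ≠ ∞ ∧
      ∑ t ∈ range T, infoGain R α A μ t +
        condMutualInfo (tail α (T + 1)) (rewardsUpTo R T) (history R A T) μ ≤
          cumPredictiveInfo R α μ T from le_self_add.trans h.2
  induction T with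
  | zero =>
    -- Functions on `Fin 0` form a one-point type, so the initial potential is zero.
    have h0 : mutualInfo (tail α 1) (fun ω ↦ (history R A 0 ω, rewardsUpTo R 0 ω)) μ = 0 :=
      mutualInfo_of_subsingleton (hαm 0)
    rw [mutualInfo_prodMk (hαm 0) (hRt 0) (hH 0), add_eq_zero] at h0
    exact ⟨by simp [mutualInfo_of_subsingleton (hαm 0)], by simp [h0.2]⟩
  | succ T ih =>
    have hsucc : cumPredictiveInfo R α μ (T + 1) =
        cumPredictiveInfo R α μ T + incrPredictiveInfo R α μ T := sum_range_succ _ _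
    rw [hsucc] at hV ⊢
    obtain ⟨hJ, ih⟩ := ih (ne_top_of_le_ne_top hV le_self_add)
    obtain ⟨g, hg, hgα⟩ := exists_measurable_tail_succ α (T + 1)
    have hgα' : tail α (T + 1 + 1) = fun ω ↦ g (tail α (T + 1) ω) := funext hgα
    have hJ' : mutualInfo (tail α (T + 1 + 1)) (rewardsUpTo R T) μ ≠ ∞ := by
      rw [hgα']
      exact ne_top_of_le_ne_top hJ (mutualInfo_comp_le (hαm T) (hRt T) hg measurable_id)
    have hD : condMutualInfo (tail α (T + 1 + 1)) (rewardsUpTo R T) (history R A T) μ ≤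
        condMutualInfo (tail α (T + 1)) (rewardsUpTo R T) (history R A T) μ := by
      rw [hgα']
      exact condMutualInfo_comp_le (hαm T) (hRt T) (hH T) hg
    have hsplit := fun n ↦ hA.mutualInfo_rewardsUpTo hR n (hgm (T + 1))
      (tail_eq_comp_rewardSeq hα (T + 1))
    have hrew : mutualInfo (tail α (T + 1 + 1)) (rewardsUpTo R (T + 1)) μ =
        mutualInfo (tail α (T + 1 + 1)) (rewardsUpTo R T) μ + incrPredictiveInfo R α μ T :=
      mutualInfo_fin_succ (hαm (T + 1)) (u := fun n ↦ R (n + 1)) (fun n ↦ hR _ (by omega)) T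
    have hhist : mutualInfo (tail α (T + 1 + 1)) (history R A (T + 1)) μ =
        mutualInfo (tail α (T + 1 + 1)) (history R A T) μ + infoGain R α A μ T :=
      mutualInfo_fin_succ (hαm (T + 1)) (u := fun n ω ↦ (A n ω, R (n + 1) ω (A n ω)))
        (measurable_actionReward hR hA.measurable) T
    have hJH : mutualInfo (tail α (T + 1 + 1)) (history R A T) μ ≠ ∞ :=
      ne_top_of_le_ne_top hJ' ((hsplit T).symm ▸ le_self_add)
    refine ⟨?_, ?_⟩
    · rw [hrew]
      exact ENNReal.add_ne_top.2 ⟨hJ', (ENNReal.add_ne_top.1 hV).2⟩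
    · have hkey : infoGain R α A μ T +
          condMutualInfo (tail α (T + 1 + 1)) (rewardsUpTo R (T + 1)) (history R A (T + 1)) μ =
          condMutualInfo (tail α (T + 1 + 1)) (rewardsUpTo R T) (history R A T) μ +
            incrPredictiveInfo R α μ T := by
        have := hsplit (T + 1)
        rw [hrew, hhist, hsplit T, add_assoc, add_assoc (mutualInfo _ _ _)] at this
        exact ((ENNReal.add_right_inj hJH).1 this).symm
      rw [sum_range_succ, add_assoc, hkey, ← add_assoc]
      gcongr
      exact (by gcongr : _ ≤ _).trans ih

end InformationGain

/-- The Cauchy-Schwarz inequality behind information-ratio bounds. -/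
lemma sum_le_sqrt_sum_ratio_mul {ι : Type*} (s : Finset ι) (r : ι → ℝ) (I : ι → ℝ≥0∞) {V : ℝ≥0∞}
    (hI : ∑ i ∈ s, I i ≤ V) (hV : V ≠ ∞)
    (hΓ : ∑ i ∈ s, ENNReal.ofReal (r i ^ 2) / I i ≠ ∞) :
    ((∑ i ∈ s, r i : ℝ) : EReal) ≤
      (((∑ i ∈ s, ENNReal.ofReal (r i ^ 2) / I i) * V) ^ (1 / 2 : ℝ) : ℝ≥0∞) := by
  set Γ : ι → ℝ≥0∞ := fun i ↦ ENNReal.ofReal (r i ^ 2) / I i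
  have hI' : ∑ i ∈ s, I i ≠ ∞ := ne_top_of_le_ne_top hV hI
  have hIi : ∀ i ∈ s, I i ≠ ∞ := fun i hi ↦ ENNReal.sum_ne_top.1 hI' i hi
  have hΓi : ∀ i ∈ s, Γ i ≠ ∞ := fun i hi ↦ ENNReal.sum_ne_top.1 hΓ i hi
  have hr : ∀ i ∈ s, r i ^ 2 = (Γ i).toReal * (I i).toReal := fun i hi ↦ by
    have h : Γ i * I i = ENNReal.ofReal (r i ^ 2) := by
      refine ENNReal.div_mul_cancel' (fun h0 ↦ ?_) (fun h ↦ absurd h (hIi i hi))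
      by_contra hne
      -- A zero gain with nonzero regret would make the ratio infinite.
      exact hΓi i hi (by simp only [Γ, h0]; exact ENNReal.div_zero hne)
    rw [← ENNReal.toReal_mul, h, ENNReal.toReal_ofReal (sq_nonneg _)]
  have hCS : (∑ i ∈ s, r i) ^ 2 ≤ ((∑ i ∈ s, Γ i) * V).toReal := by
    refine (sum_sq_le_sum_mul_sum_of_sq_le_mul s (fun i _ ↦ ENNReal.toReal_nonneg)
      (fun i _ ↦ ENNReal.toReal_nonneg)
      fun i hi ↦ (hr i hi).le).trans ?_
    rw [ENNReal.toReal_mul, ← ENNReal.toReal_sum hΓi, ← ENNReal.toReal_sum hIi]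
    gcongr
  have hfin : ((∑ i ∈ s, Γ i) * V) ^ (1 / 2 : ℝ) ≠ ∞ :=
    ENNReal.rpow_ne_top_of_nonneg (by norm_num) (ENNReal.mul_ne_top hΓ hV)
  rw [← EReal.coe_ennreal_toReal hfin, EReal.coe_le_coe_iff, ← ENNReal.toReal_rpow,
    ← Real.sqrt_eq_rpow]
  exact Real.le_sqrt_of_sq_le hCS

end NSBandit

theorem theorem2
    {Ω : Type*} [MeasurableSpace Ω] (μ : Measure Ω) [IsProbabilityMeasure μ]
    {𝓐 : Type*} [Fintype 𝓐] [Nonempty 𝓐] [MeasurableSpace 𝓐] [MeasurableSingletonClass 𝓐]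
    -- the bandit
    (R : ℕ → Ω → 𝓐 → ℝ) (hR : ∀ t, 1 ≤ t → Measurable (R t))
    (hRint : ∀ t, 1 ≤ t → ∀ a, Integrable (fun ω ↦ R t ω a) μ)
    -- the deterministic functions and the process `α_t = f_t(R_t)`
    {S : ℕ → Type*} [∀ t, MeasurableSpace (S t)]
    (f : (t : ℕ) → (𝓐 → ℝ) → S t) (hf : ∀ t, 1 ≤ t → Measurable (f t))
    (α : (t : ℕ) → Ω → S t) (hα : ∀ t, 1 ≤ t → ∀ ω, α t ω = f t (R t ω))
    -- the process `χ`
    {C : ℕ → Type*} [∀ t, MeasurableSpace (C t)]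
    (χ : (t : ℕ) → Ω → C t) (hχ : ∀ t, Measurable (χ t))
    -- the policy and the actions of an agent that executes it
    (π : NSBandit.Policy 𝓐) (A : ℕ → Ω → 𝓐) (hA : NSBandit.IsExecution R π A μ)
    (T : ℕ) (hT : 1 ≤ T)
    -- the product on the right-hand side is not of the indeterminate form `0 · ∞` or `∞ · 0`
    (h0top : NSBandit.cumPredictiveInfo R α μ T = ∞ →
      ∑ t ∈ range T, NSBandit.infoRatio R χ α A μ t ≠ 0)
    (htop0 : ∑ t ∈ range T, NSBandit.infoRatio R χ α A μ t = ∞ →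
      NSBandit.cumPredictiveInfo R α μ T ≠ 0) :
    (NSBandit.regret R χ A μ T : EReal) ≤
      (((∑ t ∈ range T, NSBandit.infoRatio R χ α A μ t) *
        NSBandit.cumPredictiveInfo R α μ T) ^ (1 / 2 : ℝ) : ℝ≥0∞) := by

  -- If either factor is infinite, the other is nonzero and the right-hand side is `∞`.
  by_cases hV : NSBandit.cumPredictiveInfo R α μ T = ∞
  · rw [hV, ENNReal.mul_top (h0top hV), ENNReal.top_rpow_of_pos (by norm_num)]
    exact le_top
  by_cases hΓ : ∑ t ∈ range T, NSBandit.infoRatio R χ α A μ t = ∞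
  · rw [hΓ, ENNReal.top_mul (htop0 hΓ), ENNReal.top_rpow_of_pos (by norm_num)]
    exact le_top
  exact NSBandit.sum_le_sqrt_sum_ratio_mul (range T) (NSBandit.instRegret R χ A μ)
    (NSBandit.infoGain R α A μ) (hA.sum_infoGain_le hR hf hα T hV) hV hΓ
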